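/- Let $\mathfrak H=\{z\in\mathbb C:\operatorname{Im}z>0\}$, $q=e^{2\pi i z}$, $\eta(z)=q^{1/24}\prod_{n\ge1}(1-q^n)$ (with $q^{1/24}=e^{2\pi i z/24}$) and $E_4(z)=1+240\sum_{n\ge1}\sigma_3(n)q^n$. A holomorphic modular form of weight $2$ with character for $\mathrm{SL}_2(\mathbb Z)$ is a holomorphic function $f:\mathfrak H\to\mathbb C$, bounded as $\operatorname{Im}z\to\infty$, such that for some group homomorphism $\chi:\mathrm{SL}_2(\mathbb Z)\to\mathbb C^\times$ one has $(cz+d)^{-2}f(\gamma z)=\chi(\gamma)f(z)$ for all $z\in\mathfrak H$ and all $\gamma=\begin{pmatrix}a&b\\c&d\end{pmatrix}\in\mathrm{SL}_2(\mathbb Z)$. For a holomorphic function $h$ with nonvanishing derivative put $\{h,z\}=(h''/h')'-\tfrac12(h''/h')^2$. (1) A function $f:\mathfrak H\to\mathbb C$ is a holomorphic modular form of weight $2$ with character for $\mathrm{SL}_2(\mathbb Z)$ having no zero in $\mathfrak H$ if and only if $f=c\,\eta^4$ for some $c\in\mathbb C^\times$. (2) The function $h(z)=\int_i^z\eta^4(\omega)\,d\omega$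 on $\mathfrak H$ (the integral along the straight segment from $i$ to $z$) is holomorphic with $h'=\eta^4$, and it is $\varrho$-equivariant: there is a homomorphism $\varrho:\mathrm{SL}_2(\mathbb Z)\to\mathrm{GL}_2(\mathbb C)$, reducible as a representation on $\mathbb C^2$ and with $\varrho(-I)$ a scalar matrix, such that $h(\gamma z)=\varrho(\gamma)\cdot h(z)$ for all $\gamma\in\mathrm{SL}_2(\mathbb Z)$ and $z\in\mathfrak H$, where $\mathrm{GL}_2(\mathbb C)$ acts on $\mathbb C\cup\{\infty\}$ by Möbius transformations. (3) $h$ satisfies the Schwarzian equation $\{h,z\}=2\pi^2r^2E_4(z)$ on $\mathfrak H$ with $r=\tfrac16$, that is, $\{h,z\}=\tfrac{\pi^2}{18}E_4(z)$. (4) The function $y=\eta^{-2}$ is holomorphic on $\mathfrak H$ and solves $y''+\tfrac{\pi^2}{36}E_4\,y=0$. -/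

import Mathlib

open UpperHalfPlane ModularForm
open scoped MatrixGroups Manifold Real

namespace EtaFour

/-- `f` is a holomorphic modular form of weight `k` with character `χ` for `SL(2, ℤ)`:
it is holomorphic on `ℍ`, satisfies `f ∣[k] γ = χ(γ) f` for all `γ`, and is holomorphic at the
cusp `i∞` (that is, bounded as `Im z → ∞`, as in Mathlib's `ModularForm`). -/
structure IsModularFormWithCharacter (k : ℤ) (χ : SL(2, ℤ) →* ℂˣ) (f : ℍ → ℂ) : Prop where
  holo : MDifferentiable 𝓘(ℂ) 𝓘(ℂ) f
  slash_eq : ∀ γ : SL(2, ℤ), f ∣[k] γ = (χ γ : ℂ) • f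
  bdd_at_infty : IsBoundedAtImInfty f

/-- The Schwarzian derivative `{h, z} = (h''/h')' - (1/2) (h''/h')²`. -/
noncomputable def schwarzian (h : ℂ → ℂ) (z : ℂ) : ℂ :=
  deriv (fun w ↦ deriv (deriv h) w / deriv h w) z - 1 / 2 * (deriv (deriv h) z / deriv h z) ^ 2

/-- `h(γ z) = ρ(γ) · h(z)` for all `γ ∈ SL(2, ℤ)` and `z ∈ ℍ`, where `GL(2, ℂ)` acts on the
Riemann sphere `ℂ ∪ {∞}` by Möbius transformations. -/
def IsEquivariant (ρ : SL(2, ℤ) →* GL (Fin 2) ℂ) (h : ℍ → OnePoint ℂ) : Prop :=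
  ∀ (γ : SL(2, ℤ)) (z : ℍ), h (γ • z) = ρ γ • h z

/-- The two-dimensional representation `ρ` has a proper nonzero invariant subspace. -/
def IsReducible (ρ : SL(2, ℤ) →* GL (Fin 2) ℂ) : Prop :=
  ∃ W : Submodule ℂ (Fin 2 → ℂ), W ≠ ⊥ ∧ W ≠ ⊤ ∧
    ∀ γ : SL(2, ℤ), ∀ v ∈ W, ((ρ γ : GL (Fin 2) ℂ) : Matrix (Fin 2) (Fin 2) ℂ).mulVec v ∈ W

/-- `y` is holomorphic on the upper half-plane and satisfies `y'' + s E₄ y = 0` there. -/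
def SolvesModularODE (s : ℂ) (y : ℂ → ℂ) : Prop :=
  DifferentiableOn ℂ y upperHalfPlaneSet ∧
    ∀ z : ℍ, deriv (deriv y) (z : ℂ) + s * E₄ z * y (z : ℂ) = 0

/-- The integral `h(z) = ∫_i^z η(ω)⁴ dω`, taken along the straight segment
`ω = i + t (z - i)`, `0 ≤ t ≤ 1`, which lies in the upper half-plane when `z` does. -/
noncomputable def etaIntegral (z : ℂ) : ℂ :=
  ∫ t in (0 : ℝ)..1, eta (Complex.I + (t : ℂ) * (z - Complex.I)) ^ 4 * (z - Complex.I)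

/-- Mathlib's `E₄` is the series `1 + 240 ∑_{n ≥ 1} σ₃(n) qⁿ`, `q = exp(2πiz)`. -/
theorem E4_eq_qSeries (z : ℍ) :
    E₄ z = 1 + 240 * ∑' n : ℕ+, (ArithmeticFunction.sigma 3 n : ℂ) *
      Complex.exp (2 * π * Complex.I * z) ^ (n : ℕ) := by
  have h := EisensteinSeries.q_expansion_bernoulli (k := 4) (by norm_num) (by decide) z
  have hb : bernoulli 4 = -1 / 30 := by
    rw [bernoulli_eq_bernoulli'_of_ne_one (by norm_num), bernoulli'_four]
  rw [h, hb]
  norm_num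

end EtaFour

namespace EtaFour
open EisensteinSeries Derivative Filter Topology

/-! Uniqueness: a character of SL₂(ℤ) has order dividing 12, so `f ^ 12` is a level-one form of
weight 24 without zeros. Dividing by Δ as often as possible leaves only `c Δ² = c η⁴⁸`, and
comparing logarithmic derivatives on the connected half-plane gives `f = d η⁴`
(`exists_eq_mul_discriminant_pow`, `exists_eq_const_mul_of_pow`).

Equivariance: weight 2 cancels the derivative `(cz + d)⁻²` of `γ`, so `h ∘ γ` and `χ(γ) h` have the
same derivative. Hence `γ` acts on `h` by an affine map, that is, by an upper triangular matrix.

Differential equations: `h''/h' = 4 η'/η = (πi/3) E₂`, and Ramanujan's identity `D E₂ = (E₂² -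
E₄)/12` makes `E₂²` cancel. The identity holds because `D E₂ - E₂²/12` is a form of weight 4, a
one-dimensional space, with value `-1/12` at the cusp. -/

/-! ### Ramanujan's identity for `E2` -/

/-- The derivative of a periodic holomorphic function that is bounded at `i∞` tends to `0`. -/
theorem isZeroAtImInfty_normalizedDeriv {f : ℍ → ℂ}
    (hper : Function.Periodic (f ∘ ofComplex) (1 : ℝ)) (hf : MDiff f)
    (hbdd : IsBoundedAtImInfty f) : IsZeroAtImInfty (normalizedDerivOfComplex f) := by
  set g := cuspFunction 1 f
  have hg : DifferentiableOn ℂ g (Metric.ball 0 1) :=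
    differentiableOn_cuspFunction_ball one_pos hper hf hbdd
  have hq := qParam_tendsto_atImInfty (one_pos (α := ℝ))
  have hcont : ContinuousAt (deriv g) 0 :=
    ((hg.deriv Metric.isOpen_ball).differentiableAt
      (Metric.ball_mem_nhds 0 one_pos)).continuousAt
  -- By the chain rule `D f = q g'(q)`; `g'` is continuous at `0`, and `q → 0` at the cusp.
  have hlim : Tendsto (fun z : ℍ ↦ Function.Periodic.qParam 1 z *
      deriv g (Function.Periodic.qParam 1 z)) atImInfty (𝓝 (0 * deriv g 0)) :=
    hq.mul (hcont.tendsto.comp hq)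
  rw [zero_mul] at hlim
  refine hlim.congr fun z ↦ ?_
  have hmem : Function.Periodic.qParam 1 z ∈ Metric.ball (0 : ℂ) 1 := by
    simpa using Function.Periodic.norm_qParam_lt_one one_pos z.im_pos
  have hEq : (f ∘ ofComplex) =ᶠ[𝓝 (z : ℂ)] g ∘ Function.Periodic.qParam 1 := by
    filter_upwards [isOpen_upperHalfPlaneSet.mem_nhds z.im_pos] with w hw
    have := eq_cuspFunction (⟨w, hw⟩ : ℍ) one_ne_zero hper
    simp only [Function.comp_apply, ofComplex_apply_of_im_pos hw]
    exact this.symm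
  have hqd : HasDerivAt (Function.Periodic.qParam 1)
      (2 * π * Complex.I * Function.Periodic.qParam 1 z) (z : ℂ) := by
    have h1 := logDeriv_qParam 1 (z : ℂ)
    rw [logDeriv_apply, div_eq_iff (Function.Periodic.qParam_ne_zero _)] at h1
    have h2 : DifferentiableAt ℂ (Function.Periodic.qParam 1) (z : ℂ) := by fun_prop
    simpa [h1] using h2.hasDerivAt
  have hgd : HasDerivAt g (deriv g (Function.Periodic.qParam 1 z)) (Function.Periodic.qParam 1 z) :=
    (hg.differentiableAt (Metric.isOpen_ball.mem_nhds hmem)).hasDerivAt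
  rw [normalizedDerivOfComplex, hEq.deriv_eq, (hgd.comp (z : ℂ) hqd).deriv]
  field

theorem denom_T (z : ℍ) : denom ModularGroup.T z = 1 := by
  rw [ModularGroup.denom_apply, ModularGroup.coe_T]
  simp

theorem E2_vadd_one (z : ℍ) : E2 ((1 : ℝ) +ᵥ z) = E2 z := by
  have h := congrFun (E2_slash_action ModularGroup.T) z
  rw [D2_T, SL_slash_apply, modular_T_smul, denom_T] at h
  simpa using h

theorem periodic_comp_ofComplex_of_vadd {f : ℍ → ℂ} (h : ∀ z : ℍ, f ((1 : ℝ) +ᵥ z) = f z) :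
    Function.Periodic (f ∘ ofComplex) (1 : ℝ) := by
  intro w
  by_cases hw : 0 < w.im
  · have hw' : 0 < (w + (1 : ℝ)).im := by simpa using hw
    simp only [Function.comp_apply, ofComplex_apply_of_im_pos hw, ofComplex_apply_of_im_pos hw']
    rw [← h ⟨w, hw⟩]
    congr 1
    ext
    simp [add_comm]
  -- Off `ℍ`, `ofComplex` takes one fixed default value, so periodicity is trivial there.
  · have hw' : (w + (1 : ℝ)).im ≤ 0 := by simpa using hw
    simp only [Function.comp_apply, ofComplex_apply_of_im_nonpos hw',
      ofComplex_apply_of_im_nonpos (not_lt.mp hw)]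

theorem periodic_E2 : Function.Periodic (E2 ∘ ofComplex) (1 : ℝ) :=
  periodic_comp_ofComplex_of_vadd E2_vadd_one

theorem tendsto_E2_atImInfty : Tendsto E2 atImInfty (𝓝 1) := by
  have hA := analyticAt_cuspFunction_zero one_pos periodic_E2 E2_mdifferentiable
    isBoundedAtImInfty_E2
  have hS := hasFPowerSeriesOnBall_cuspFunction (h := 1) (f := E2) one_pos hA (fun τ ↦ by
    simpa only [Function.Periodic.qParam, Complex.ofReal_one, div_one]
      using hasSum_qExpansion_E2 (z := τ))
  have h0 : cuspFunction 1 E2 0 = 1 := by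
    rw [← hS.coeff_zero (fun _ ↦ 0)]; simp [FormalMultilinearSeries.ofScalars]
  rw [← h0]
  exact (hA.continuousAt.tendsto.comp (qParam_tendsto_atImInfty one_pos)).congr
    fun z ↦ eq_cuspFunction z one_ne_zero periodic_E2

theorem tendsto_E4_atImInfty : Tendsto E₄ atImInfty (𝓝 1) := by
  have hA := ModularFormClass.analyticAt_cuspFunction_zero E₄ one_pos one_mem_strictPeriods_SL
  have h0 : cuspFunction 1 E₄ 0 = 1 := by
    simpa [qExpansion_coeff] using E_qExpansion_coeff_zero (k := 4) (by norm_num) ⟨2, rfl⟩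
  rw [← h0]
  exact (hA.continuousAt.tendsto.comp (qParam_tendsto_atImInfty one_pos)).congr
    fun z ↦ SlashInvariantFormClass.eq_cuspFunction E₄ z one_mem_strictPeriods_SL one_ne_zero

/-- A holomorphic function that is invariant under `SL(2, ℤ)` in weight `k` and bounded at `i∞`
is a modular form. -/
noncomputable def levelOneForm {k : ℤ} (f : ℍ → ℂ) (hf : MDiff f)
    (hslash : ∀ γ : SL(2, ℤ), f ∣[k] γ = f) (hbdd : IsBoundedAtImInfty f) : ModularForm 𝒮ℒ k where
  toFun := f
  slash_action_eq' := fun _ ⟨γ, hγ⟩ ↦ hγ ▸ hslash γ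
  holo' := hf
  bdd_at_cusps' {c} hc := by
    rw [Subgroup.IsArithmetic.isCusp_iff_isCusp_SL2Z] at hc
    rw [OnePoint.isBoundedAt_iff_forall_SL2Z hc]
    intro γ _
    rwa [hslash γ]

/-- `D E₂ - E₂² / 12`, which Ramanujan's identity equates with `-E₄ / 12`. -/
noncomputable def ramanujanE2 (z : ℍ) : ℂ := normalizedDerivOfComplex E2 z - E2 z ^ 2 / 12

theorem mdifferentiable_ramanujanE2 : MDiff ramanujanE2 := by
  have h : ramanujanE2 = normalizedDerivOfComplex E2 - (12⁻¹ : ℂ) • (E2 * E2) := by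
    ext z; simp [ramanujanE2]; ring
  rw [h]
  exact (normalizedDerivOfComplex_mdifferentiable E2_mdifferentiable).sub
    ((E2_mdifferentiable.mul E2_mdifferentiable).const_smul _)

theorem tendsto_ramanujanE2_atImInfty : Tendsto ramanujanE2 atImInfty (𝓝 (-1 / 12)) := by
  have h1 := isZeroAtImInfty_normalizedDeriv periodic_E2 E2_mdifferentiable isBoundedAtImInfty_E2
  have h := h1.sub ((tendsto_E2_atImInfty.pow 2).div_const 12)
  norm_num at h ⊢
  exact h

theorem D2_comp_ofComplex_eqOn (γ : SL(2, ℤ)) : Set.EqOn (D2 γ ∘ ofComplex)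
    (fun w ↦ 2 * π * Complex.I * γ 1 0 * denom γ w ^ (-1 : ℤ)) upperHalfPlaneSet := by
  intro w hw
  simp only [Function.comp_apply, D2, ofComplex_apply_of_im_pos hw, coe_mk, zpow_neg_one]
  rfl

theorem mdifferentiable_D2 (γ : SL(2, ℤ)) : MDiff (D2 γ) := by
  rw [UpperHalfPlane.mdifferentiable_iff]
  refine DifferentiableOn.congr (fun w hw ↦ ?_) (D2_comp_ofComplex_eqOn γ)
  exact ((hasDerivAt_denom_zpow γ (-1) ⟨w, hw⟩).const_mul _).differentiableAt.differentiableWithinAt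

theorem normalizedDeriv_D2 (γ : SL(2, ℤ)) (z : ℍ) :
    normalizedDerivOfComplex (D2 γ) z = -((γ 1 0 : ℂ) / denom γ z) ^ 2 := by
  have hEq := (D2_comp_ofComplex_eqOn γ).eventuallyEq_of_mem
    (isOpen_upperHalfPlaneSet.mem_nhds z.im_pos)
  have hz := denom_ne_zero γ z
  have hγ : ((γ : GL (Fin 2) ℝ) 1 0 : ℂ) = γ 1 0 := by simp
  rw [normalizedDerivOfComplex, hEq.deriv_eq,
    ((hasDerivAt_denom_zpow γ (-1) z).const_mul _).deriv, hγ]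
  norm_num [zpow_neg]
  field_simp
  rw [Complex.I_sq, neg_one_mul]

/-- With `u = c/(cz + d)`, both `D E₂` and `E₂²/12` acquire the same correction `-(i/π) u E₂ -
3u²/π²` under `γ`, so it drops out of the difference. -/
theorem ramanujanE2_slash (γ : SL(2, ℤ)) : ramanujanE2 ∣[(4 : ℤ)] γ = ramanujanE2 := by
  ext z
  have hz := denom_ne_zero γ z
  have hE := E2_slash_action γ
  have hEz : (E2 ∣[(2 : ℤ)] γ) z = E2 z - 1 / (2 * riemannZeta 2) * D2 γ z := by simp [hE]
  have hD := congrFun (normalizedDerivOfComplex_SL_slash (k := 2) E2_mdifferentiable (γ := γ)) z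
  rw [hE, normalizedDerivOfComplex_sub _ _ E2_mdifferentiable
    ((mdifferentiable_D2 γ).const_smul _), normalizedDerivOfComplex_smul _ _ (mdifferentiable_D2 γ)]
    at hD
  simp only [Pi.sub_apply, Pi.smul_apply, smul_eq_mul, normalizedDeriv_D2, D2] at hD hEz
  have hR : (ramanujanE2 ∣[(4 : ℤ)] γ) z = (normalizedDerivOfComplex E2 ∣[(2 + 2 : ℤ)] γ) z -
      (E2 ∣[(2 : ℤ)] γ) z ^ 2 / 12 := by
    simp only [ramanujanE2, SL_slash_apply]
    norm_num [zpow_neg]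
    field
  rw [hR, ramanujanE2, hEz]
  rw [riemannZeta_two] at *
  set u := (γ 1 0 : ℂ) / denom γ z with hu
  have hu2 : 2 * π * Complex.I * (γ 1 0 : ℂ) / denom γ z = 2 * π * Complex.I * u := by
    rw [hu]; ring
  rw [hu2] at hD ⊢
  have hpi : (π : ℂ) ≠ 0 := by exact_mod_cast Real.pi_ne_zero
  have hI2 := Complex.I_sq
  push_cast at hD
  field_simp at hD ⊢
  grind

/-- **Ramanujan's identity** for the derivative of `E₂`. -/
theorem normalizedDeriv_E2 (z : ℍ) :
    normalizedDerivOfComplex E2 z = (E2 z ^ 2 - E₄ z) / 12 := by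
  let R : ModularForm 𝒮ℒ 4 := levelOneForm ramanujanE2 mdifferentiable_ramanujanE2
    ramanujanE2_slash (tendsto_ramanujanE2_atImInfty.isBigO_one ℝ)
  obtain ⟨c, hc⟩ := (finrank_eq_one_iff_of_nonzero' E₄ (E_ne_zero _ ⟨2, rfl⟩)).mp
    (Module.rank_eq_one_iff_finrank_eq_one.mp levelOne_weight_four_rank_one) R
  have hcz (z : ℍ) : c * E₄ z = ramanujanE2 z := congrArg (fun F : ModularForm 𝒮ℒ 4 ↦ F z) hc
  have hc1 : c = -1 / 12 := by
    have h1 := (tendsto_E4_atImInfty.const_mul c).congr hcz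
    simpa using tendsto_nhds_unique h1 tendsto_ramanujanE2_atImInfty
  have := hcz z
  rw [hc1, ramanujanE2] at this
  linear_combination -this

/-! ### `η⁴` as a form of weight 2 with character -/

/-- The function `η⁴` on the upper half-plane. -/
noncomputable def etaFour (z : ℍ) : ℂ := eta (z : ℂ) ^ 4

theorem etaFour_ne_zero (z : ℍ) : etaFour z ≠ 0 := pow_ne_zero _ (eta_ne_zero z.2)

theorem mdifferentiable_etaFour : MDiff etaFour := by
  rw [UpperHalfPlane.mdifferentiable_iff]
  refine .congr (fun z hz ↦ ((differentiableAt_eta_of_mem_upperHalfPlaneSet hz).fun_pow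
    4).differentiableWithinAt) fun z hz ↦ ?_
  simp [etaFour, ofComplex_apply_of_im_pos hz]

theorem isBoundedAtImInfty_etaFour : IsBoundedAtImInfty etaFour := by
  -- Δ = η²⁴ tends to `0`, so `|η| ≤ 1` far up.
  obtain ⟨A, hA⟩ := isZeroAtImInfty_iff.mp discriminant_isZeroAtImInfty 1 one_pos
  refine isBoundedAtImInfty_iff.mpr ⟨1, A, fun z hz ↦ ?_⟩
  have h := hA z hz
  rw [discriminant, norm_pow] at h
  rw [etaFour, norm_pow]
  exact pow_le_one₀ (norm_nonneg _) ((pow_le_one_iff_of_nonneg (norm_nonneg _) (by norm_num)).mp h)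

theorem sqrt_pow_four (z : ℂ) : Complex.sqrt z ^ 4 = z ^ 2 := by
  rw [show Complex.sqrt z ^ 4 = (Complex.sqrt z ^ 2) ^ 2 by ring]
  congr 1
  rw [Complex.sqrt, ← Complex.cpow_nat_mul]
  norm_num

theorem etaFour_slash_S : etaFour ∣[(2 : ℤ)] ModularGroup.S = (-1 : ℂ) • etaFour := by
  ext z
  have he := eta_comp_eq_csqrt_I_inv z.2
  have hz := ne_zero z
  simp only [Function.comp_apply, Pi.smul_apply, Pi.mul_apply, smul_eq_mul] at he
  rw [SlashInvariantForm.slash_S_apply]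
  have h : etaFour (.mk _ z.im_inv_neg_coe_pos) = eta (-1 / (z : ℂ)) ^ 4 := by
    simp [etaFour, neg_div]
  -- The fourth power removes the branch of the square root; the sign `-1` is `I ^ 2`.
  rw [h, he, mul_pow, mul_pow, inv_pow, sqrt_pow_four, sqrt_pow_four, Complex.I_sq]
  simp only [Pi.smul_apply, etaFour, smul_eq_mul, zpow_neg, zpow_ofNat]
  field

theorem eta_add_one (z : ℂ) : eta (z + 1) = Complex.exp (2 * π * Complex.I / 24) * eta z := by
  have h1 : Function.Periodic.qParam 1 (z + 1) = Function.Periodic.qParam 1 z := by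
    rw [Function.Periodic.qParam, Function.Periodic.qParam,
      ← Complex.exp_periodic (2 * π * Complex.I * z / (1 : ℝ))]
    congr 1
    push_cast
    ring
  have h24 : Function.Periodic.qParam 24 (z + 1) =
      Complex.exp (2 * π * Complex.I / 24) * Function.Periodic.qParam 24 z := by
    rw [Function.Periodic.qParam, Function.Periodic.qParam, ← Complex.exp_add]
    congr 1
    push_cast
    ring
  simp only [eta, eta_q, h1, h24, mul_assoc]

theorem etaFour_slash_T : etaFour ∣[(2 : ℤ)] ModularGroup.T =
    (Complex.exp (2 * π * Complex.I / 24) ^ 4) • etaFour := by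
  ext z
  rw [SL_slash_apply, modular_T_smul, denom_T]
  simp [etaFour, coe_vadd, add_comm (1 : ℂ), eta_add_one, mul_pow]

theorem induction_SL2Z {p : SL(2, ℤ) → Prop} (one : p 1) (S : p ModularGroup.S)
    (T : p ModularGroup.T) (mul : ∀ a b, p a → p b → p (a * b)) (inv : ∀ a, p a → p a⁻¹)
    (γ : SL(2, ℤ)) : p γ := by
  have h : γ ∈ Subgroup.closure {ModularGroup.S, ModularGroup.T} := by
    rw [SpecialLinearGroup.SL2Z_generators]; trivial
  induction h using Subgroup.closure_induction with
  | mem x hx => rcases hx with rfl | rfl <;> assumption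
  | one => exact one
  | mul x y _ _ hx hy => exact mul x y hx hy
  | inv x _ hx => exact inv x hx

/-- A nonzero function that is an eigenvector for the slash operators of `S` and `T`
transforms under a character of `SL(2, ℤ)`. -/
theorem exists_character {k : ℤ} {f : ℍ → ℂ} (hf : f ≠ 0) {s t : ℂˣ}
    (hS : f ∣[k] ModularGroup.S = (s : ℂ) • f) (hT : f ∣[k] ModularGroup.T = (t : ℂ) • f) :
    ∃ χ : SL(2, ℤ) →* ℂˣ, ∀ γ : SL(2, ℤ), f ∣[k] γ = (χ γ : ℂ) • f := by
  have hmul {a b : SL(2, ℤ)} {c d : ℂˣ} (ha : f ∣[k] a = (c : ℂ) • f)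
      (hb : f ∣[k] b = (d : ℂ) • f) : f ∣[k] (a * b) = ((c * d : ℂˣ) : ℂ) • f := by
    rw [SlashAction.slash_mul, ha, SL_smul_slash, hb, smul_smul, Units.val_mul]
  have hex (γ : SL(2, ℤ)) : ∃ c : ℂˣ, f ∣[k] γ = (c : ℂ) • f := by
    refine induction_SL2Z (p := fun γ ↦ ∃ c : ℂˣ, f ∣[k] γ = (c : ℂ) • f)
      ⟨1, by simp⟩ ⟨s, hS⟩ ⟨t, hT⟩ (fun a b ⟨c, hc⟩ ⟨d, hd⟩ ↦ ⟨c * d, hmul hc hd⟩)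
      (fun a ⟨c, hc⟩ ↦ ⟨c⁻¹, ?_⟩) γ
    have h : (c : ℂ) • (f ∣[k] a⁻¹) = f := by
      rw [← SL_smul_slash, ← hc, ← SlashAction.slash_mul]
      simp
    rw [← h, smul_smul, h]
    simp
  choose χ hχ using hex
  have huniq {c d : ℂˣ} (h : (c : ℂ) • f = (d : ℂ) • f) : c = d :=
    Units.ext (smul_left_injective ℂ hf h)
  exact ⟨MonoidHom.mk' χ fun a b ↦ huniq ((hχ _).symm.trans (hmul (hχ a) (hχ b))), hχ⟩

theorem exists_etaFour_character :
    ∃ χ : SL(2, ℤ) →* ℂˣ, IsModularFormWithCharacter 2 χ etaFour := by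
  have h0 : etaFour ≠ 0 := fun h ↦ etaFour_ne_zero I (congrFun h I)
  obtain ⟨χ, hχ⟩ := exists_character (s := -1)
    (t := Units.mk0 (Complex.exp (2 * π * Complex.I / 24) ^ 4) (pow_ne_zero _ (Complex.exp_ne_zero _)))
    h0 (by simpa using etaFour_slash_S) etaFour_slash_T
  exact ⟨χ, mdifferentiable_etaFour, hχ, isBoundedAtImInfty_etaFour⟩

/-! ### Uniqueness of `η⁴` -/

/-- Every character of `SL(2, ℤ)` has order dividing `12`. -/
theorem character_pow_twelve (χ : SL(2, ℤ) →* ℂˣ) (γ : SL(2, ℤ)) : χ γ ^ 12 = 1 := by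
  -- The relations `S⁴ = 1` and `(ST)³ = S²` give `χ(S)⁴ = 1` and `χ(T)³ = χ(S)⁻¹`.
  have h4 : (ModularGroup.S ^ 4 : SL(2, ℤ)) = 1 := by decide
  have h6 : ((ModularGroup.S * ModularGroup.T) ^ 3 : SL(2, ℤ)) = ModularGroup.S ^ 2 := by decide
  have hs : χ ModularGroup.S ^ 4 = 1 := by rw [← map_pow, h4, map_one]
  have hst : χ ModularGroup.S * χ ModularGroup.T ^ 3 = 1 := by
    have h := congrArg χ h6
    rw [map_pow, map_pow, map_mul, mul_pow, pow_succ (χ ModularGroup.S) 2, mul_assoc] at h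
    exact mul_eq_left.mp h
  refine induction_SL2Z (p := fun γ ↦ χ γ ^ 12 = 1) (by simp) ?_ ?_ ?_ ?_ γ
  · rw [show 12 = 4 * 3 from rfl, pow_mul, hs, one_pow]
  · have h := congrArg (· ^ 4) hst
    simpa only [mul_pow, hs, one_mul, ← pow_mul, one_pow] using h
  · intro a b ha hb; rw [map_mul, mul_pow, ha, hb, one_mul]
  · intro a ha; rw [map_inv, inv_pow, ha, inv_one]

theorem pow_slash {k m : ℤ} (n : ℕ) (hm : m = n * k) (f : ℍ → ℂ) (γ : SL(2, ℤ)) :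
    (f ^ n) ∣[m] γ = (f ∣[k] γ) ^ n := by
  ext z
  rw [SL_slash_apply, Pi.pow_apply, Pi.pow_apply, SL_slash_apply, mul_pow, hm,
    ← zpow_natCast (_ ^ (-k)), ← zpow_mul]
  congr 2
  ring

/-- A nowhere vanishing modular form of level one is a scalar multiple of a power of `Δ`. -/
theorem exists_eq_mul_discriminant_pow {k : ℕ} (f : ModularForm 𝒮ℒ (k : ℤ)) (hf : ∀ z, f z ≠ 0) :
    ∃ (c : ℂ) (m : ℕ), k = 12 * m ∧ ∀ z, f z = c * discriminant z ^ m := by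
  induction k using Nat.strong_induction_on with | _ k ih =>
  by_cases h0 : (qExpansion 1 f).coeff 0 = 0
  -- A cusp form is divisible by Δ, and the quotient still has no zeros. Below weight 12 it would
  -- have negative weight and vanish.
  · let g := CuspForm.discriminantEquiv (toCuspForm f h0)
    have hg (z : ℍ) : f z = discriminant z * g z :=
      (discriminant_mul_discriminantEquiv_apply (toCuspForm f h0) z).symm
    have hg0 (z : ℍ) : g z ≠ 0 := fun h ↦ hf z (by rw [hg, h, mul_zero])
    rcases lt_or_ge k 12 with hk | hk
    · have := congrFun (ModularFormClass.levelOne_neg_weight_eq_zero (by lia) g) I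
      exact absurd this (hg0 I)
    · obtain ⟨c, m, hkm, hc⟩ := ih (k - 12) (by lia)
        (ModularForm.mcast (b := ((k - 12 : ℕ) : ℤ)) (by lia) g) hg0
      refine ⟨c, m + 1, by lia, fun z ↦ ?_⟩
      have hcz : g z = c * discriminant z ^ m := hc z
      rw [hg, hcz]
      ring
  -- With a nonzero value at the cusp, `1/f` is bounded there and is a form of weight `-k`, which
  -- forces `k = 0`.
  · have hA := ModularFormClass.analyticAt_cuspFunction_zero f one_pos one_mem_strictPeriods_SL
    have hlim : Tendsto f atImInfty (𝓝 (cuspFunction 1 f 0)) :=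
      (hA.continuousAt.tendsto.comp (qParam_tendsto_atImInfty one_pos)).congr
        fun z ↦ SlashInvariantFormClass.eq_cuspFunction f z one_mem_strictPeriods_SL one_ne_zero
    have h0' : cuspFunction 1 f 0 ≠ 0 := by simpa [qExpansion_coeff] using h0
    have hinv : MDiff (fun z ↦ (f z)⁻¹) := by
      rw [UpperHalfPlane.mdifferentiable_iff]
      exact (UpperHalfPlane.mdifferentiable_iff.mp f.holo').inv fun z _ ↦ hf _
    let g : ModularForm 𝒮ℒ (-k : ℤ) := levelOneForm (fun z ↦ (f z)⁻¹) hinv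
      (fun γ ↦ by
        ext z
        have h := congrFun (SlashInvariantFormClass.slash_action_eq f γ ⟨γ, rfl⟩) z
        rw [← SL_slash, SL_slash_apply] at h
        rw [SL_slash_apply, ← h, mul_inv, ← zpow_neg])
      ((hlim.inv₀ h0').isBigO_one ℝ)
    rcases Nat.eq_zero_or_pos k with rfl | hk
    · obtain ⟨c, hc⟩ := ModularFormClass.levelOne_weight_zero_const f
      exact ⟨c, 0, rfl, fun z ↦ by simp [hc]⟩
    · have := congrFun (ModularFormClass.levelOne_neg_weight_eq_zero (by lia) g) I
      exact absurd this (inv_ne_zero (hf I))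

/-- Two holomorphic functions without zeros whose `n`-th powers are proportional are
themselves proportional. -/
theorem exists_eq_const_mul_of_pow {f g : ℍ → ℂ} (hf : MDiff f) (hg : MDiff g)
    (hf0 : ∀ z, f z ≠ 0) (hg0 : ∀ z, g z ≠ 0) {n : ℕ} (hn : n ≠ 0) {c : ℂ}
    (h : ∀ z, f z ^ n = c * g z ^ n) : ∃ d : ℂ, d ≠ 0 ∧ ∀ z, f z = d * g z := by
  have hf' := UpperHalfPlane.mdifferentiable_iff.mp hf
  have hg' := UpperHalfPlane.mdifferentiable_iff.mp hg
  have hc : c ≠ 0 := fun hc ↦ pow_ne_zero n (hf0 I) (by rw [h, hc, zero_mul])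
  have hlog : Set.EqOn (logDeriv (f ∘ ofComplex)) (logDeriv (g ∘ ofComplex))
      upperHalfPlaneSet := by
    intro z hz
    have hfz := hf'.differentiableAt (isOpen_upperHalfPlaneSet.mem_nhds hz)
    have hgz := hg'.differentiableAt (isOpen_upperHalfPlaneSet.mem_nhds hz)
    have heq : (fun w ↦ (f ∘ ofComplex) w ^ n) = fun w ↦ c * (g ∘ ofComplex) w ^ n :=
      funext fun w ↦ h _
    have h1 := congrArg (logDeriv · z) heq
    beta_reduce at h1
    rw [logDeriv_const_mul _ _ hc, logDeriv_fun_pow hfz, logDeriv_fun_pow hgz] at h1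
    exact mul_left_cancel₀ (Nat.cast_ne_zero.mpr hn) h1
  obtain ⟨d, hd, hfg⟩ := (logDeriv_eqOn_iff hf' hg' isOpen_upperHalfPlaneSet
    (convex_halfSpace_im_gt 0).isPreconnected (fun z _ ↦ hg0 _) (fun z _ ↦ hf0 _)).mp hlog
  exact ⟨d, hd, fun z ↦ by simpa using hfg z.2⟩

/-- A nowhere vanishing form of weight two with character is a multiple of `η⁴`. -/
theorem IsModularFormWithCharacter.exists_eq_const_mul_etaFour {χ : SL(2, ℤ) →* ℂˣ} {f : ℍ → ℂ}
    (hf : IsModularFormWithCharacter 2 χ f) (hf0 : ∀ z, f z ≠ 0) :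
    ∃ c : ℂ, c ≠ 0 ∧ ∀ z, f z = c * etaFour z := by
  have hhol : MDiff (f ^ 12) := hf.holo.pow 12
  have hbdd : IsBoundedAtImInfty (f ^ 12) := by
    obtain ⟨M, A, h⟩ := isBoundedAtImInfty_iff.mp hf.bdd_at_infty
    refine isBoundedAtImInfty_iff.mpr ⟨M ^ 12, A, fun z hz ↦ ?_⟩
    rw [Pi.pow_apply, norm_pow]
    exact pow_le_pow_left₀ (norm_nonneg _) (h z hz) 12
  let F : ModularForm 𝒮ℒ ((24 : ℕ) : ℤ) := levelOneForm (f ^ 12) hhol (fun γ ↦ by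
    have hχ : (χ γ : ℂ) ^ 12 = 1 := by
      rw [← Units.val_pow_eq_pow_val, character_pow_twelve, Units.val_one]
    rw [pow_slash (k := 2) 12 (by norm_num), hf.slash_eq, smul_pow, hχ, one_smul]) hbdd
  obtain ⟨c, m, hm, hc⟩ := exists_eq_mul_discriminant_pow F fun z ↦ pow_ne_zero 12 (hf0 z)
  obtain rfl : m = 2 := by lia
  refine exists_eq_const_mul_of_pow hf.holo mdifferentiable_etaFour hf0 etaFour_ne_zero
    (n := 12) (c := c) (by norm_num) fun z ↦ ?_
  have hcz : f z ^ 12 = c * discriminant z ^ 2 := hc z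
  rw [hcz, etaFour, discriminant, ← pow_mul, ← pow_mul]

/-- Multiples of a form with character are forms with the same character. -/
theorem IsModularFormWithCharacter.const_smul {k : ℤ} {χ : SL(2, ℤ) →* ℂˣ} {f : ℍ → ℂ}
    (hf : IsModularFormWithCharacter k χ f) (c : ℂ) :
    IsModularFormWithCharacter k χ (c • f) where
  holo := hf.holo.const_smul c
  slash_eq γ := by rw [SL_smul_slash, hf.slash_eq, smul_comm]
  bdd_at_infty := hf.bdd_at_infty.const_smul_left c

/-! ### The primitive of `η⁴` and its monodromy representation -/

/-- The segment integral of `η⁴` is a primitive of `η⁴` on the upper half-plane. -/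
theorem hasDerivAt_etaIntegral (z : ℍ) :
    HasDerivAt etaIntegral (eta (z : ℂ) ^ 4) (z : ℂ) := by
  -- The 1-form `η⁴ dw` is closed because its derivative is complex bilinear in one variable, hence
  -- symmetric. The Poincaré lemma on the convex half-plane applies.
  let ω : ℂ → ℂ →L[ℂ] ℂ := fun w ↦ ContinuousLinearMap.toSpanSingleton ℂ (eta w ^ 4)
  let L : ℂ →L[ℂ] ℂ →L[ℂ] ℂ := ContinuousLinearMap.toSpanSingletonCLE.toContinuousLinearMap
  have hω (w : ℂ) (hw : w ∈ upperHalfPlaneSet) :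
      HasFDerivWithinAt ω (((L.comp (ContinuousLinearMap.toSpanSingleton ℂ
        (deriv (fun x ↦ eta x ^ 4) w))).restrictScalars ℝ)) upperHalfPlaneSet w := by
    have h := ((differentiableAt_eta_of_mem_upperHalfPlaneSet hw).fun_pow 4).hasDerivAt.hasFDerivAt
    exact ((L.hasFDerivAt.comp w h).restrictScalars ℝ).hasFDerivWithinAt
  have key :=
    (convex_halfSpace_im_gt 0).hasFDerivWithinAt_curveIntegral_segment_of_hasFDerivWithinAt_symmetric
      (a := Complex.I) (b := (z : ℂ)) hω (fun a ha x _ y _ ↦ by simp [L]; ring) (by simp) z.2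
  have h : etaIntegral = fun w ↦ curveIntegral ω (.segment Complex.I w) := by
    funext w
    rw [curveIntegral_segment, etaIntegral]
    congr 1
    ext t
    simp [AffineMap.lineMap_apply, add_comm, mul_comm]
  rw [h]
  simpa [ω] using (key.hasFDerivAt (isOpen_upperHalfPlaneSet.mem_nhds z.2)).hasDerivAt

theorem etaIntegral_I : etaIntegral Complex.I = 0 := by simp [etaIntegral]

/-- If `η⁴` has character `χ`, its primitive `h` satisfies `h(γ z) = χ(γ) h(z) + h(γ i)`. -/
theorem etaIntegral_smul {χ : SL(2, ℤ) →* ℂˣ} (hχ : IsModularFormWithCharacter 2 χ etaFour)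
    (γ : SL(2, ℤ)) (z : ℍ) :
    etaIntegral (γ • z : ℍ) = χ γ * etaIntegral z + etaIntegral (γ • I : ℍ) := by
  let d : ℂ → ℂ := fun w ↦ etaIntegral (γ • ofComplex w : ℍ) - χ γ * etaIntegral w
  have hdet : (γ : GL (Fin 2) ℝ).val.det = 1 := by
    rw [← Matrix.GeneralLinearGroup.val_det_apply]; simp
  have hd (w : ℍ) : HasDerivAt d 0 (w : ℂ) := by
    have h1 : HasDerivAt (fun w ↦ ((γ • ofComplex w : ℍ) : ℂ)) (1 / denom γ w ^ 2) (w : ℂ) := by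
      have h := (hasStrictDerivAt_smul (g := (γ : GL (Fin 2) ℝ)) (by rw [hdet]; exact one_pos)
        w).hasDerivAt
      rw [hdet, Complex.ofReal_one] at h
      exact h
    have h2 := hasDerivAt_etaIntegral (γ • ofComplex (w : ℂ))
    have h3 := (h2.comp (w : ℂ) h1).sub ((hasDerivAt_etaIntegral w).const_mul (χ γ : ℂ))
    have hs := congrFun (hχ.slash_eq γ) w
    rw [SL_slash_apply] at hs
    simp only [etaFour, Pi.smul_apply, smul_eq_mul, zpow_neg, zpow_ofNat] at hs
    exact h3.congr_deriv (by rw [← hs, ofComplex_apply, one_div, sub_self])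
  have hconst : d z = d I :=
    (convex_halfSpace_im_gt 0).is_const_of_fderivWithin_eq_zero (𝕜 := ℂ)
      (fun w hw ↦ (hd ⟨w, hw⟩).differentiableAt.differentiableWithinAt)
      (fun w hw ↦ by
        rw [fderivWithin_of_isOpen isOpen_upperHalfPlaneSet hw]
        simpa using (hd ⟨w, hw⟩).hasFDerivAt.fderiv) z.2 I.2
  simp only [d, ofComplex_apply, coe_I, etaIntegral_I, mul_zero, sub_zero] at hconst
  rw [← ofComplex_apply I, coe_I]
  linear_combination hconst

/-- The representation `γ ↦ !![χ γ, h(γ i); 0, 1]`. -/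
noncomputable def etaRep {χ : SL(2, ℤ) →* ℂˣ} (hχ : IsModularFormWithCharacter 2 χ etaFour) :
    SL(2, ℤ) →* GL (Fin 2) ℂ :=
  MonoidHom.mk' (fun γ ↦ Matrix.GeneralLinearGroup.mkOfDetNeZero
    !![(χ γ : ℂ), etaIntegral (γ • I : ℍ); 0, 1] (by simp)) fun a b ↦ by
      ext i j
      fin_cases i <;> fin_cases j <;>
        simp [Matrix.GeneralLinearGroup.mkOfDetNeZero, Matrix.mul_apply, Fin.sum_univ_two]
      -- Only the upper right entry remains: it is the cocycle relation for `γ ↦ h(γ i)`.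
      simpa [mul_smul] using etaIntegral_smul hχ a (b • I)

theorem coe_etaRep {χ : SL(2, ℤ) →* ℂˣ} (hχ : IsModularFormWithCharacter 2 χ etaFour)
    (γ : SL(2, ℤ)) : (etaRep hχ γ : Matrix (Fin 2) (Fin 2) ℂ) =
      !![(χ γ : ℂ), etaIntegral (γ • I : ℍ); 0, 1] := rfl

theorem isReducible_etaRep {χ : SL(2, ℤ) →* ℂˣ} (hχ : IsModularFormWithCharacter 2 χ etaFour) :
    IsReducible (etaRep hχ) := by
  -- The first coordinate axis is stable under upper triangular matrices.
  refine ⟨LinearMap.ker (LinearMap.proj (R := ℂ) (φ := fun _ : Fin 2 ↦ ℂ) 1), ?_, ?_, ?_⟩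
  · rw [Submodule.ne_bot_iff]
    exact ⟨![1, 0], by simp, fun h ↦ by simpa using congrFun h 0⟩
  · intro h
    have : (![0, 1] : Fin 2 → ℂ) ∈ (⊤ : Submodule ℂ (Fin 2 → ℂ)) := trivial
    rw [← h] at this
    simp at this
  · intro γ v hv
    simp only [LinearMap.mem_ker, LinearMap.proj_apply] at hv ⊢
    simp [coe_etaRep, Matrix.mulVec, dotProduct, Fin.sum_univ_two, hv]

theorem isEquivariant_etaRep {χ : SL(2, ℤ) →* ℂˣ} (hχ : IsModularFormWithCharacter 2 χ etaFour) :
    IsEquivariant (etaRep hχ) (fun z : ℍ ↦ ((etaIntegral (z : ℂ) : ℂ) : OnePoint ℂ)) := by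
  intro γ z
  rw [OnePoint.smul_some_eq_ite, coe_etaRep]
  simpa using etaIntegral_smul hχ γ z

/-- As `-I` fixes `i` and the weight is even, `χ(-I) = 1` and the translation part is `h(i) = 0`. -/
theorem etaRep_neg_one {χ : SL(2, ℤ) →* ℂˣ} (hχ : IsModularFormWithCharacter 2 χ etaFour) :
    (etaRep hχ (-1) : Matrix (Fin 2) (Fin 2) ℂ) = (1 : ℂ) • 1 := by
  have hsmul : (-1 : SL(2, ℤ)) • I = I := by simp
  have h := congrFun (hχ.slash_eq (-1)) I
  have hden : denom (-1 : SL(2, ℤ)) I = -1 := by simp [denom]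
  rw [SL_slash_apply, hsmul, hden] at h
  have hone : (χ (-1) : ℂ) = 1 := by
    simpa [etaFour_ne_zero] using h.symm
  rw [coe_etaRep, hsmul, coe_I, etaIntegral_I, hone, one_smul, Matrix.one_fin_two]

/-! ### The Schwarzian and the linear equation -/

theorem deriv_eta (z : ℍ) : deriv eta z = π * Complex.I / 12 * E2 z * eta z := by
  rw [← logDeriv_eta_eq_E2, logDeriv_apply, div_mul_cancel₀ _ (eta_ne_zero z.2)]

theorem hasDerivAt_eta (z : ℍ) : HasDerivAt eta (π * Complex.I / 12 * E2 z * eta z) (z : ℂ) := by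
  rw [← deriv_eta]
  exact (differentiableAt_eta_of_mem_upperHalfPlaneSet z.2).hasDerivAt

/-- Ramanujan's identity in terms of the complex derivative. -/
theorem hasDerivAt_E2 (z : ℍ) :
    HasDerivAt (E2 ∘ ofComplex) (π * Complex.I / 6 * (E2 z ^ 2 - E₄ z)) (z : ℂ) := by
  have h := normalizedDeriv_E2 z
  have hd := (UpperHalfPlane.mdifferentiableAt_iff.mp (E2_mdifferentiable z)).hasDerivAt
  rw [normalizedDerivOfComplex, inv_mul_eq_iff_eq_mul₀ Complex.two_pi_I_ne_zero] at h
  exact hd.congr_deriv (by rw [h]; ring)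

/-- The derivative on `ℍ` depends only on the values on `ℍ`. -/
theorem deriv_eq_of_forall_upperHalfPlane {f g : ℂ → ℂ} (h : ∀ z : ℍ, f z = g z) {z : ℍ} {g' : ℂ}
    (hg : HasDerivAt g g' (z : ℂ)) : deriv f z = g' := by
  have hfg : f =ᶠ[𝓝 (z : ℂ)] g :=
    Filter.mem_of_superset (isOpen_upperHalfPlaneSet.mem_nhds z.2) fun w hw ↦ h ⟨w, hw⟩
  rw [hfg.deriv_eq, hg.deriv]

theorem schwarzian_etaIntegral (z : ℍ) : schwarzian etaIntegral z = (π : ℂ) ^ 2 / 18 * E₄ z := by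
  have h1 (w : ℍ) : deriv etaIntegral w = eta w ^ 4 := (hasDerivAt_etaIntegral w).deriv
  have h2 (w : ℍ) : deriv (deriv etaIntegral) w = π * Complex.I / 3 * E2 w * eta w ^ 4 := by
    rw [deriv_eq_of_forall_upperHalfPlane h1 ((hasDerivAt_eta w).fun_pow 4)]
    norm_num
    ring
  have h3 (w : ℍ) : deriv (deriv etaIntegral) w / deriv etaIntegral w =
      π * Complex.I / 3 * (E2 ∘ ofComplex) w := by
    rw [h1, h2, mul_div_cancel_right₀ _ (pow_ne_zero 4 (eta_ne_zero w.2)), Function.comp_apply,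
      ofComplex_apply]
  rw [schwarzian, h3, deriv_eq_of_forall_upperHalfPlane h3 ((hasDerivAt_E2 z).const_mul _),
    Function.comp_apply, ofComplex_apply]
  -- The `E₂²` terms are `(πi/3)(πi/6)` from Ramanujan's identity and `-(1/2)(πi/3)²` from the
  -- square; they cancel.
  linear_combination (-(π : ℂ) ^ 2 / 18 * E₄ z) * Complex.I_sq

/-- Here `η⁻²` plays the role of `(h')^(-1/2)`, so the coefficient is half the Schwarzian of `h`.
Directly, `y' = -(πi/6) E₂ y`, and `E₂²` cancels in `y''`. -/
theorem solvesModularODE_inv_eta_sq :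
    SolvesModularODE ((π : ℂ) ^ 2 / 36) (fun z : ℂ ↦ (eta z ^ 2)⁻¹) := by
  have hy (z : ℍ) : HasDerivAt (fun z : ℂ ↦ (eta z ^ 2)⁻¹)
      (-(π * Complex.I / 6) * (E2 ∘ ofComplex) z * (eta z ^ 2)⁻¹) (z : ℂ) := by
    have hz := eta_ne_zero z.2
    refine (((hasDerivAt_eta z).fun_pow 2).fun_inv (pow_ne_zero 2 hz)).congr_deriv ?_
    simp only [Function.comp_apply, ofComplex_apply]
    field_simp
    norm_num
    ring
  refine ⟨fun z hz ↦ (hy ⟨z, hz⟩).differentiableAt.differentiableWithinAt, fun z ↦ ?_⟩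
  rw [deriv_eq_of_forall_upperHalfPlane (fun w ↦ (hy w).deriv)
    (((hasDerivAt_E2 z).const_mul _).fun_mul (hy z))]
  simp only [Function.comp_apply, ofComplex_apply]
  linear_combination ((π : ℂ) ^ 2 / 36 * E₄ z * (eta z ^ 2)⁻¹) * Complex.I_sq

end EtaFour

theorem mainTheorem3 :
    -- up to nonzero scalars, `η⁴` is the only nowhere-vanishing holomorphic modular form
    -- of weight `2` with character
    (∀ f : ℍ → ℂ,
      ((∃ χ : SL(2, ℤ) →* ℂˣ, EtaFour.IsModularFormWithCharacter 2 χ f) ∧ ∀ z : ℍ, f z ≠ 0) ↔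
        ∃ c : ℂ, c ≠ 0 ∧ ∀ z : ℍ, f z = c * eta (z : ℂ) ^ 4) ∧
    -- `h` is a holomorphic primitive of `η⁴`
    (∀ z : ℍ, HasDerivAt EtaFour.etaIntegral (eta (z : ℂ) ^ 4) (z : ℂ)) ∧
    -- `h` is `ρ`-equivariant for a reducible `ρ` with `ρ(-I)` scalar
    (∃ ρ : SL(2, ℤ) →* GL (Fin 2) ℂ,
      (∃ c : ℂ, ((ρ (-1) : GL (Fin 2) ℂ) : Matrix (Fin 2) (Fin 2) ℂ) = c • 1) ∧
      EtaFour.IsReducible ρ ∧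
      EtaFour.IsEquivariant ρ (fun z : ℍ ↦ ((EtaFour.etaIntegral (z : ℂ) : ℂ) : OnePoint ℂ))) ∧
    -- the Schwarzian equation `{h, z} = 2 π² r² E₄` with `r = 1/6`
    (∀ z : ℍ, EtaFour.schwarzian EtaFour.etaIntegral (z : ℂ) =
        2 * (π : ℂ) ^ 2 * (1 / 6) ^ 2 * E₄ z ∧
      EtaFour.schwarzian EtaFour.etaIntegral (z : ℂ) = (π : ℂ) ^ 2 / 18 * E₄ z) ∧
    -- `η⁻²` solves `y'' + (π²/36) E₄ y = 0`
    EtaFour.SolvesModularODE ((π : ℂ) ^ 2 / 36) (fun z : ℂ ↦ (eta z ^ 2)⁻¹) := by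
  obtain ⟨χ, hχ⟩ := EtaFour.exists_etaFour_character
  refine ⟨fun f ↦ ⟨fun ⟨⟨_, hf⟩, hf0⟩ ↦ hf.exists_eq_const_mul_etaFour hf0,
    fun ⟨c, hc, hf⟩ ↦ ⟨⟨χ, ?_⟩, fun z ↦ ?_⟩⟩, EtaFour.hasDerivAt_etaIntegral,
    ⟨EtaFour.etaRep hχ, ⟨1, EtaFour.etaRep_neg_one hχ⟩, EtaFour.isReducible_etaRep hχ,
      EtaFour.isEquivariant_etaRep hχ⟩,
    fun z ↦ ⟨?_, EtaFour.schwarzian_etaIntegral z⟩, EtaFour.solvesModularODE_inv_eta_sq⟩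
  · rw [show f = c • EtaFour.etaFour from funext hf]
    exact hχ.const_smul c
  · rw [hf]
    exact mul_ne_zero hc (EtaFour.etaFour_ne_zero z)
  · rw [EtaFour.schwarzian_etaIntegral]
    ring
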